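/- Let $m,k\ge 1$ be integers and let $\mathbb{N}^m$ be the set of multi-indices $\alpha=(\alpha_1,\dots,\alpha_m)$ of non-negative integers, with $e_i$ the $i$-th unit multi-index. Let $\Lambda=\{\lambda_\alpha\}_{\alpha\in\mathbb{N}^m}$ be a set of weights with $0<\lambda_\alpha<\infty$ such that $(*)$ $\lambda_\alpha\ge\lambda_{\alpha+e_i}$ for all $\alpha\in\mathbb{N}^m$ and $1\le i\le m$. Let $\mathcal{M}_\Lambda$ be the complex Hilbert space spanned by orthogonal vectors $Z^\alpha$, $\alpha\in\mathbb{N}^m$, with $\|Z^\alpha\|=\lambda_\alpha$, and let $Z_i$ be the (contractive) operator on $\mathcal{M}_\Lambda$ with $Z_iZ^\alpha=Z^{\alpha+e_i}$, $1\le i\le m$. For $0<p<\infty$ let $\mathcal{C}_p$ denote the Schatten $p$-class, i.e. the bounded operators whose singular values (the distances to the operators of rank at most $n$, $n=0,1,2,\dots$) are $p$-summable. Assume $(**)_p$ $[Z_i,Z_j^*]=Z_iZ_j^*-Z_j^*Z_i\in\mathcal{C}_p$ for $1\le i,j\le m$. Let $C$ be any set of pairs $(\alpha,x)$ with $\alpha\in\mathbb{N}^m$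 and $x\in\mathbb{C}^k$, and let $\mathcal{S}$ be the submodule of $\mathcal{M}_\Lambda\otimes\mathbb{C}^k$ generated by the monomials $Z^\alpha\otimes x$, $(\alpha,x)\in C$; that is, the smallest closed subspace of $\mathcal{M}_\Lambda\otimes\mathbb{C}^k$ that contains these monomials and is invariant under $Z_1\otimes I,\dots,Z_m\otimes I$. Let $Y_i=(Z_i\otimes I)|_{\mathcal{S}}$, as an operator on $\mathcal{S}$. Then all cross-commutators $[Y_i,Y_j^*]=Y_iY_j^*-Y_j^*Y_i$, $1\le i,j\le m$, lie in the Schatten class $\mathcal{C}_p$ of operators on $\mathcal{S}$. -/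

import Mathlib

open scoped TensorProduct InnerProductSpace

noncomputable section

/-! ### Schatten classes and cross-commutators -/

section Schatten

variable {H K : Type*} [NormedAddCommGroup H] [InnerProductSpace ℂ H]
  [NormedAddCommGroup K] [InnerProductSpace ℂ K]

/-- The `n`-th singular value (`s`-number, `n = 0, 1, 2, …`) of a bounded operator `T` between
Hilbert spaces: the distance in operator norm from `T` to the operators of rank at most `n`.
For compact `T` these are the eigenvalues of `|T| = (T* T)^{1/2}` in decreasing order, repeated
according to multiplicity. -/
def singularNumber (T : H →L[ℂ] K) (n : ℕ) : ℝ :=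
  sInf {r : ℝ | ∃ F : H →L[ℂ] K, LinearMap.rank (F : H →ₗ[ℂ] K) ≤ (n : Cardinal) ∧ r = ‖T - F‖}

/-- Membership in the Schatten `p`-class, `0 < p < ∞`: the sequence of singular values is
`p`-summable. (The singular values then tend to `0`, so that `T` is in particular compact.) -/
def IsSchatten (p : ℝ) (T : H →L[ℂ] K) : Prop :=
  Summable fun n : ℕ => singularNumber T n ^ p

/-- The cross-commutator `[A, B*] = A B* - B* A`. -/
def crossCommutator [CompleteSpace H] (A B : H →L[ℂ] H) : H →L[ℂ] H :=
  A * ContinuousLinearMap.adjoint B - ContinuousLinearMap.adjoint B * A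

end Schatten

/-! ### Submodules of a Hilbert module over the polynomials

A Hilbert module over `ℂ[z₁, …, z_m]` is given by the operators `T i` of multiplication by the
coordinate functions. -/

section HilbertSubmodule

variable {ι H : Type*} [NormedAddCommGroup H] [InnerProductSpace ℂ H]

/-- A submodule of the Hilbert module `(H, T)`: a closed subspace that is invariant under the
coordinate operators (equivalently, under all polynomials in them). -/
structure HilbertSubmodule (T : ι → H →L[ℂ] H) extends Submodule ℂ H where
  isClosed' : IsClosed (toSubmodule : Set H)
  map_mem' : ∀ i, ∀ x ∈ toSubmodule, T i x ∈ toSubmodule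

namespace HilbertSubmodule

variable {T : ι → H →L[ℂ] H}

instance [CompleteSpace H] (S : HilbertSubmodule T) : CompleteSpace S.toSubmodule :=
  S.isClosed'.completeSpace_coe

/-- The submodule generated by a set `G`: the smallest submodule that contains `G`. -/
def generate (T : ι → H →L[ℂ] H) (G : Set H) : HilbertSubmodule T where
  toSubmodule := sInf {N : Submodule ℂ H |
    IsClosed (N : Set H) ∧ (∀ i, ∀ x ∈ N, T i x ∈ N) ∧ G ⊆ N}
  isClosed' := by
    rw [Submodule.coe_sInf]
    exact isClosed_biInter fun N hN => hN.1
  map_mem' := by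
    intro i x hx
    rw [Submodule.mem_sInf] at hx ⊢
    exact fun N hN => hN.2.1 i x (hx N hN)

/-- The coordinate operators of a submodule: the restrictions of the `T i` to it. -/
def coord (S : HilbertSubmodule T) (i : ι) : S.toSubmodule →L[ℂ] S.toSubmodule :=
  ((T i).comp S.toSubmodule.subtypeL).codRestrict S.toSubmodule
    fun x => S.map_mem' i x x.2

end HilbertSubmodule

end HilbertSubmodule

/-! ### Completeness of `H ⊗ ℂᵏ` -/

/-- The algebraic tensor product of a Hilbert space with `ℂᵏ` is complete, hence it is the Hilbert
space tensor product. -/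
instance tensorEuclidean_completeSpace {H : Type*} [NormedAddCommGroup H] [InnerProductSpace ℂ H]
    [CompleteSpace H] (k : ℕ) : CompleteSpace (H ⊗[ℂ] EuclideanSpace ℂ (Fin k)) := by
  let b : Fin k → EuclideanSpace ℂ (Fin k) := fun i => EuclideanSpace.single i 1
  let e : PiLp 2 (fun _ : Fin k => H) →ₗ[ℂ] H ⊗[ℂ] EuclideanSpace ℂ (Fin k) :=
    { toFun := fun v => ∑ i, v i ⊗ₜ[ℂ] b i
      map_add' := fun v w => by simp [TensorProduct.add_tmul, Finset.sum_add_distrib]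
      map_smul' := fun c v => by simp [← TensorProduct.smul_tmul', Finset.smul_sum] }
  have hinner : ∀ v w, inner ℂ (e v) (e w) = inner ℂ v w := by
    intro v w
    change inner ℂ (∑ i, v i ⊗ₜ[ℂ] b i) (∑ i, w i ⊗ₜ[ℂ] b i) = _
    simp [sum_inner, inner_sum, PiLp.inner_apply, b]
  let e' : PiLp 2 (fun _ : Fin k => H) →ₗᵢ[ℂ] H ⊗[ℂ] EuclideanSpace ℂ (Fin k) :=
    e.isometryOfInner hinner
  have hsurj : Function.Surjective e' := by
    intro t
    induction t using TensorProduct.induction_on with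
    | zero => exact ⟨0, map_zero _⟩
    | tmul x y =>
      refine ⟨WithLp.toLp 2 fun i => y i • x, ?_⟩
      change (∑ i, (y i • x) ⊗ₜ[ℂ] b i) = _
      simp only [TensorProduct.smul_tmul, ← TensorProduct.tmul_sum]
      congr 1
      ext j
      simp [b, Pi.single_apply]
    | add s t hs ht =>
      obtain ⟨u, rfl⟩ := hs
      obtain ⟨v, rfl⟩ := ht
      exact ⟨u + v, map_add _ _ _⟩
  exact (LinearIsometryEquiv.ofSurjective e' hsurj).symm.toIsometryEquiv.completeSpace

/-! ### Weighted shift modules -/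

/-- Multi-indices `α = (α₁, …, α_m)` of non-negative integers. -/
abbrev MultiIndex (m : ℕ) : Type := Fin m → ℕ

/-- A set of weights `Λ = {λ_α}`, `0 < λ_α < ∞`. -/
structure WeightSet (m : ℕ) where
  weight : MultiIndex m → ℝ
  weight_pos : ∀ α, 0 < weight α

namespace WeightSet

variable {m : ℕ} (Λ : WeightSet m)

/-- Condition `(*)`: `λ_α ≥ λ_{α + e_i}` for all `α` and `i`. -/
def IsDecreasing : Prop :=
  ∀ (α : MultiIndex m) (i : Fin m), Λ.weight (α + Pi.single i 1) ≤ Λ.weight α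

/-- The Hilbert space `M_Λ` spanned by orthogonal vectors `Z^α` with `‖Z^α‖ = λ_α`, realised as
`ℓ²` of the multi-indices: `f α` is the coefficient of `f` at the unit vector `Z^α / λ_α`. -/
abbrev Space {m : ℕ} (_Λ : WeightSet m) : Type := lp (fun _ : MultiIndex m => ℂ) 2

/-- The monomial `Z^α` in `M_Λ`. -/
def monomial (α : MultiIndex m) : Λ.Space := lp.single 2 α (Λ.weight α : ℂ)

/-- Multiplication by `z_i` in terms of the coefficients at the unit vectors `Z^β / λ_β`. -/
def coordFun (i : Fin m) (f : MultiIndex m → ℂ) (β : MultiIndex m) : ℂ :=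
  if β i = 0 then 0
  else (Λ.weight β / Λ.weight (β - Pi.single i 1) : ℝ) * f (β - Pi.single i 1)

theorem coordFun_add_single (i : Fin m) (f : MultiIndex m → ℂ) (α : MultiIndex m) :
    Λ.coordFun i f (α + Pi.single i 1) =
      (Λ.weight (α + Pi.single i 1) / Λ.weight α : ℝ) * f α := by
  simp [coordFun]

theorem coordFun_summable (hΛ : Λ.IsDecreasing) (i : Fin m) (f : Λ.Space) :
    Summable (fun β => ‖Λ.coordFun i f β‖ ^ 2) ∧
      ∑' β, ‖Λ.coordFun i f β‖ ^ 2 ≤ ‖f‖ ^ 2 := by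
  have hinj : Function.Injective fun α : MultiIndex m => α + Pi.single i 1 :=
    add_left_injective _
  have hsupp : ∀ β ∉ Set.range (fun α : MultiIndex m => α + Pi.single i 1),
      ‖Λ.coordFun i f β‖ ^ 2 = 0 := by
    intro β hβ
    have : β i = 0 := by
      by_contra h
      refine hβ ⟨β - Pi.single i 1, ?_⟩
      funext j
      by_cases hj : j = i
      · subst hj
        simp
        omega
      · simp [hj]
    simp [coordFun, this]
  have hle : ∀ α, ‖Λ.coordFun i f (α + Pi.single i 1)‖ ^ 2 ≤ ‖f α‖ ^ 2 := by
    intro α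
    rw [coordFun_add_single, norm_mul, Complex.norm_real, Real.norm_of_nonneg
      (div_nonneg (Λ.weight_pos _).le (Λ.weight_pos _).le)]
    have h1 := (div_le_one (Λ.weight_pos α)).2 (hΛ α i)
    have h2 : 0 ≤ Λ.weight (α + Pi.single i 1) / Λ.weight α :=
      div_nonneg (Λ.weight_pos _).le (Λ.weight_pos _).le
    gcongr
    exact mul_le_of_le_one_left (norm_nonneg _) h1
  have hf : HasSum (fun α => ‖f α‖ ^ 2) (‖f‖ ^ 2) := by
    simpa using lp.hasSum_norm (p := 2) (by simp) f
  have hs : Summable fun α => ‖Λ.coordFun i f (α + Pi.single i 1)‖ ^ 2 :=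
    hf.summable.of_nonneg_of_le (fun _ => by positivity) hle
  refine ⟨(hinj.summable_iff hsupp).1 hs, ?_⟩
  rw [← hinj.tsum_eq (f := fun β => ‖Λ.coordFun i f β‖ ^ 2)
    (Function.support_subset_iff'.2 hsupp), ← hf.tsum_eq]
  exact hs.tsum_le_tsum hle hf.summable

/-- The operator `Z_i` on `M_Λ` of multiplication by `z_i`, a contraction by `(*)`. -/
def coordOp (hΛ : Λ.IsDecreasing) (i : Fin m) : Λ.Space →L[ℂ] Λ.Space :=
  LinearMap.mkContinuous
    { toFun := fun f => ⟨Λ.coordFun i f, memℓp_gen (by simpa using (Λ.coordFun_summable hΛ i f).1)⟩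
      map_add' := fun f g => by
        ext β
        change Λ.coordFun i (f + g) β = Λ.coordFun i f β + Λ.coordFun i g β
        by_cases h : β i = 0 <;> simp [coordFun, h, mul_add]
      map_smul' := fun c f => by
        ext β
        change Λ.coordFun i (c • f) β = c * Λ.coordFun i f β
        by_cases h : β i = 0 <;> simp [coordFun, h, mul_left_comm] }
    1 fun f => by
      rw [one_mul]
      refine lp.norm_le_of_tsum_le (by simp) (norm_nonneg f) ?_
      simpa using (Λ.coordFun_summable hΛ i f).2

theorem coordOp_monomial (hΛ : Λ.IsDecreasing) (i : Fin m) (α : MultiIndex m) :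
    Λ.coordOp hΛ i (Λ.monomial α) = Λ.monomial (α + Pi.single i 1) := by
  ext β
  change Λ.coordFun i (Λ.monomial α) β = _
  have hα : (Λ.weight α : ℂ) ≠ 0 := by exact_mod_cast (Λ.weight_pos α).ne'
  by_cases hβ : β = α + Pi.single i 1
  · subst hβ
    rw [coordFun_add_single]
    simp [monomial, hα]
  · have h1 : Λ.monomial (α + Pi.single i 1) β = 0 := lp.single_apply_ne _ _ _ hβ
    rw [h1, coordFun]
    split_ifs with h
    · rfl
    · have h2 : Λ.monomial α (β - Pi.single i 1) = 0 := by
        refine lp.single_apply_ne _ _ _ fun h3 => hβ ?_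
        rw [← h3]
        funext j
        by_cases hj : j = i
        · subst hj
          simp
          omega
        · simp [hj]
      rw [h2, mul_zero]

/-- The coordinate operators `Z_i ⊗ I` of the Hilbert module `M_Λ ⊗ ℂᵏ`. -/
def coordOpTensor (hΛ : Λ.IsDecreasing) (k : ℕ) (i : Fin m) :
    Λ.Space ⊗[ℂ] EuclideanSpace ℂ (Fin k) →L[ℂ] Λ.Space ⊗[ℂ] EuclideanSpace ℂ (Fin k) :=
  (Λ.coordOp hΛ i).rTensor (EuclideanSpace ℂ (Fin k))

/-- The submodule of `M_Λ ⊗ ℂᵏ` generated by the monomials `Z^α ⊗ x`, `(α, x) ∈ C`. -/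
def monomialSubmodule (hΛ : Λ.IsDecreasing) (k : ℕ)
    (C : Set (MultiIndex m × EuclideanSpace ℂ (Fin k))) :
    HilbertSubmodule (Λ.coordOpTensor hΛ k) :=
  HilbertSubmodule.generate (Λ.coordOpTensor hΛ k)
    {v | ∃ a ∈ C, v = Λ.monomial a.1 ⊗ₜ[ℂ] a.2}

end WeightSet

end

/-! ### Singular numbers and Schatten classes for all exponents `p > 0`. -/

section SchattenLemmas

universe u v

variable {H H' : Type*} {K K' : Type u} [NormedAddCommGroup H] [InnerProductSpace ℂ H]
  [NormedAddCommGroup K] [InnerProductSpace ℂ K] [NormedAddCommGroup H'] [InnerProductSpace ℂ H']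
  [NormedAddCommGroup K'] [InnerProductSpace ℂ K']

/-! Write `T_i = Z_i ⊗ I`, let `P` be the projection onto `S`, and let `B_i = P T_i (1 - P)`. Since
`S` is invariant, `[Y_i, Y_j*]` is the compression to `S` of `[T_i, T_j*] - B_i B_j*`
(`crossCommutator_coord`). The first term is `[Z_i, Z_j*] ⊗ I`, which is Schatten because tensoring
with `ℂᵏ` only repeats singular values `k` times. Everything rests on `B_i B_j*`, and two facts
control it.

Geometry: `S` is graded by the multi-index, with fibers `E(α) ⊆ ℂᵏ` increasing in `α`. By Dickson's
lemma and finite dimension there is a `ν` such that `E(α + e_i) = E(α)` once `α_i ≥ ν_i`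
(`exists_stable_multiIndex`). Where the fiber does not grow, `T_i` maps the complement of `S` into
itself, so `B_i` only sees the slab `α_i < ν_i` (`corner_mul_cutoffTensor`).

Analysis: put `r_i(α) = ‖Z_i Z^α‖² / ‖Z^α‖²`. The operator `[Z_i, Z_i*]` is diagonal with entries
`r_i(α - e_i) - r_i(α)`, the first term being `0` when `α_i = 0`. Its entries are `p`-summable, and
on a slab of bounded thickness `r_i` is a sum of boundedly many of them, so `r_i` is `p`-summable
there (`summable_sqRatio`).

Off a finite set of indices outside which `r_i, r_j ≤ c` on the slabs, each corner has norm at most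
`√c`, so the product is within `c` of finite rank (`isSchatten_corner_mul_adjoint_corner`). -/

theorem singularNumber_bddBelow (T : H →L[ℂ] K) (n : ℕ) :
    BddBelow {r : ℝ | ∃ F : H →L[ℂ] K,
      LinearMap.rank (F : H →ₗ[ℂ] K) ≤ (n : Cardinal) ∧ r = ‖T - F‖} :=
  ⟨0, by rintro _ ⟨F, -, rfl⟩; exact norm_nonneg _⟩

theorem singularNumber_nonneg (T : H →L[ℂ] K) (n : ℕ) : 0 ≤ singularNumber T n :=
  Real.sInf_nonneg (by rintro _ ⟨F, -, rfl⟩; exact norm_nonneg _)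

theorem singularNumber_le {T F : H →L[ℂ] K} {n : ℕ}
    (hF : LinearMap.rank (F : H →ₗ[ℂ] K) ≤ (n : Cardinal)) : singularNumber T n ≤ ‖T - F‖ :=
  csInf_le (singularNumber_bddBelow T n) ⟨F, hF, rfl⟩

theorem le_singularNumber {T : H →L[ℂ] K} {n : ℕ} {r : ℝ}
    (h : ∀ F : H →L[ℂ] K, LinearMap.rank (F : H →ₗ[ℂ] K) ≤ (n : Cardinal) → r ≤ ‖T - F‖) :
    r ≤ singularNumber T n :=
  le_csInf ⟨_, 0, by simp, rfl⟩ (by rintro _ ⟨F, hF, rfl⟩; exact h F hF)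

theorem exists_norm_sub_lt (T : H →L[ℂ] K) (n : ℕ) {ε : ℝ} (hε : 0 < ε) :
    ∃ F : H →L[ℂ] K, LinearMap.rank (F : H →ₗ[ℂ] K) ≤ (n : Cardinal) ∧
      ‖T - F‖ < singularNumber T n + ε := by
  by_contra! h
  have := le_singularNumber h
  linarith

theorem singularNumber_antitone (T : H →L[ℂ] K) : Antitone (singularNumber T) :=
  fun _ _ h => le_singularNumber fun _ hF =>
    singularNumber_le (hF.trans (Nat.cast_le.2 h))

theorem singularNumber_add_le (S T : H →L[ℂ] K) (m n : ℕ) :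
    singularNumber (S + T) (m + n) ≤ singularNumber S m + singularNumber T n := by
  refine le_of_forall_pos_le_add fun ε hε => ?_
  obtain ⟨F, hF, hF'⟩ := exists_norm_sub_lt S m (half_pos hε)
  obtain ⟨G, hG, hG'⟩ := exists_norm_sub_lt T n (half_pos hε)
  have hFG : LinearMap.rank ((F + G : H →L[ℂ] K) : H →ₗ[ℂ] K) ≤ ((m + n : ℕ) : Cardinal) := by
    rw [ContinuousLinearMap.toLinearMap_add, Nat.cast_add]
    exact (LinearMap.rank_add_le _ _).trans (add_le_add hF hG)
  have h1 := singularNumber_le (T := S + T) hFG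
  have h2 : ‖S + T - (F + G)‖ ≤ ‖S - F‖ + ‖T - G‖ := by
    rw [add_sub_add_comm]; exact norm_add_le _ _
  linarith

theorem singularNumber_comp_le (A : K →L[ℂ] K') (T : H →L[ℂ] K) (B : H' →L[ℂ] H) (n : ℕ) :
    singularNumber (A ∘L T ∘L B) n ≤ ‖A‖ * ‖B‖ * singularNumber T n := by
  have key : ∀ ε > 0, singularNumber (A ∘L T ∘L B) n ≤
      ‖A‖ * ‖B‖ * (singularNumber T n + ε) := by
    intro ε hε
    obtain ⟨F, hF, hF'⟩ := exists_norm_sub_lt T n hε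
    have hr : LinearMap.rank ((A ∘L F ∘L B : H' →L[ℂ] K') : H' →ₗ[ℂ] K') ≤ (n : Cardinal) :=
      (LinearMap.rank_comp_le_right _ _).trans ((LinearMap.rank_comp_le_left _ _).trans hF)
    have h0 : A ∘L T ∘L B - A ∘L F ∘L B = A ∘L (T - F) ∘L B := by
      ext; simp
    calc _ ≤ _ := singularNumber_le hr
      _ ≤ ‖A‖ * (‖T - F‖ * ‖B‖) := by
        rw [h0]
        refine (ContinuousLinearMap.opNorm_comp_le _ _).trans ?_
        gcongr
        exact ContinuousLinearMap.opNorm_comp_le _ _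
      _ = ‖A‖ * ‖B‖ * ‖T - F‖ := by ring
      _ ≤ _ := by gcongr
  have ht : Filter.Tendsto (fun ε : ℝ => ‖A‖ * ‖B‖ * (singularNumber T n + ε))
      (nhdsWithin 0 (Set.Ioi 0)) (nhds (‖A‖ * ‖B‖ * (singularNumber T n + 0))) :=
    ((continuous_const.mul (continuous_const.add continuous_id)).tendsto 0).mono_left
      nhdsWithin_le_nhds
  rw [add_zero] at ht
  exact ge_of_tendsto ht (eventually_mem_nhdsWithin.mono key)

/-- Summability of an antitone sequence can be tested on a multiple of the indices. -/
theorem Antitone.summable_of_summable_mul {f : ℕ → ℝ} (hf : Antitone f) {k : ℕ} (hk : k ≠ 0)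
    (h : Summable fun n => f (k * n)) : Summable f := by
  have : NeZero k := ⟨hk⟩
  rw [← summable_indicator_mod_iff hf ((0 : ℕ) : ZMod k)]
  exact (_root_.summable_indicator_mod_iff_summable k 0 f).2 (by simpa using h)

/-- Rank bounds get multiplied by `2` for sums and by `k` for tensoring with `ℂᵏ`; this absorbs such
factors. -/
theorem isSchatten_of_summable_mul {p : ℝ} (hp : 0 < p) {T : H →L[ℂ] K} {k : ℕ} (hk : k ≠ 0)
    (h : Summable fun n => singularNumber T (k * n) ^ p) : IsSchatten p T :=
  Antitone.summable_of_summable_mul (f := fun n => singularNumber T n ^ p)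
    (fun _ _ hmn => Real.rpow_le_rpow (singularNumber_nonneg T _)
      (singularNumber_antitone T hmn) hp.le) hk h

/-- A crude quasi-triangle inequality, via `a + b ≤ 2 max a b`, that treats `p < 1` and `p ≥ 1`
alike. -/
theorem add_rpow_le_two_rpow_mul {a b p : ℝ} (ha : 0 ≤ a) (hb : 0 ≤ b) (hp : 0 ≤ p) :
    (a + b) ^ p ≤ 2 ^ p * (a ^ p + b ^ p) := by
  have h : (a + b) ^ p ≤ (2 * max a b) ^ p := by
    refine Real.rpow_le_rpow (by positivity) ?_ hp
    linarith [le_max_left a b, le_max_right a b]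
  refine h.trans ?_
  rw [Real.mul_rpow (by norm_num) (le_max_of_le_left ha)]
  gcongr
  have := Real.rpow_nonneg ha p
  have := Real.rpow_nonneg hb p
  rcases max_choice a b with h | h <;> rw [h] <;> linarith

theorem IsSchatten.add {p : ℝ} (hp : 0 < p) {S T : H →L[ℂ] K} (hS : IsSchatten p S)
    (hT : IsSchatten p T) : IsSchatten p (S + T) := by
  refine isSchatten_of_summable_mul hp two_ne_zero ?_
  refine Summable.of_nonneg_of_le (fun n => Real.rpow_nonneg (singularNumber_nonneg _ _) _)
    (fun n => ?_) ((Summable.add hS hT).mul_left (2 ^ p))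
  refine le_trans (Real.rpow_le_rpow (singularNumber_nonneg _ _) ?_ hp.le)
    (add_rpow_le_two_rpow_mul (singularNumber_nonneg S n) (singularNumber_nonneg T n) hp.le)
  rw [two_mul]
  exact singularNumber_add_le S T n n

theorem IsSchatten.comp {p : ℝ} (hp : 0 < p) {T : H →L[ℂ] K} (hT : IsSchatten p T)
    (A : K →L[ℂ] K') (B : H' →L[ℂ] H) : IsSchatten p (A ∘L T ∘L B) := by
  refine Summable.of_nonneg_of_le (fun n => Real.rpow_nonneg (singularNumber_nonneg _ _) _)
    (fun n => ?_) (Summable.mul_left ((‖A‖ * ‖B‖) ^ p) hT)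
  rw [← Real.mul_rpow (by positivity) (singularNumber_nonneg _ _)]
  exact Real.rpow_le_rpow (singularNumber_nonneg _ _) (singularNumber_comp_le A T B n) hp.le

theorem IsSchatten.sub {p : ℝ} (hp : 0 < p) {S T : H →L[ℂ] K} (hS : IsSchatten p S)
    (hT : IsSchatten p T) : IsSchatten p (S - T) := by
  have h : S - T = S + (-ContinuousLinearMap.id ℂ K) ∘L T ∘L ContinuousLinearMap.id ℂ H := by
    ext
    simp [sub_eq_add_neg]
  rw [h]
  exact hS.add hp (hT.comp hp _ _)

/-- The map `F ⊗ 1` factors through `range F ⊗ E`. -/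
theorem LinearMap.rank_rTensor_le {V : Type v} {W : Type u} [AddCommGroup V] [Module ℂ V]
    [AddCommGroup W] [Module ℂ W] (F : V →ₗ[ℂ] W) (E : Type u) [AddCommGroup E] [Module ℂ E] :
    LinearMap.rank (F.rTensor E) ≤ LinearMap.rank F * Module.rank ℂ E := by
  have h : F.rTensor E = (F.range.subtype.rTensor E) ∘ₗ (F.rangeRestrict.rTensor E) := by
    rw [← LinearMap.rTensor_comp]; rfl
  rw [h]
  refine (LinearMap.rank_comp_le_left _ _).trans ((LinearMap.rank_le_domain _).trans ?_)
  rw [rank_tensorProduct']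

/-- If `F` has rank at most `n`, then `F ⊗ 1` has rank at most `k n` and approximates `T ⊗ 1` no
worse, so `s_{kn}(T ⊗ 1) ≤ s_n(T)`. -/
theorem IsSchatten.rTensor {H K : Type} [NormedAddCommGroup H] [InnerProductSpace ℂ H]
    [NormedAddCommGroup K] [InnerProductSpace ℂ K] {p : ℝ} (hp : 0 < p) {T : H →L[ℂ] K}
    (hT : IsSchatten p T) {k : ℕ} (hk : k ≠ 0) :
    IsSchatten p (T.rTensor (EuclideanSpace ℂ (Fin k))) := by
  refine isSchatten_of_summable_mul hp hk ?_
  refine Summable.of_nonneg_of_le (fun n => Real.rpow_nonneg (singularNumber_nonneg _ _) _)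
    (fun n => ?_) hT
  refine Real.rpow_le_rpow (singularNumber_nonneg _ _) (le_singularNumber fun F hF => ?_) hp.le
  have hr : LinearMap.rank (F.rTensor (EuclideanSpace ℂ (Fin k))).toLinearMap ≤
      ((k * n : ℕ) : Cardinal) := by
    rw [ContinuousLinearMap.toLinearMap_rTensor]
    refine (LinearMap.rank_rTensor_le _ _).trans ?_
    rw [mul_comm k n, Nat.cast_mul]
    refine mul_le_mul' hF (le_of_eq ?_)
    rw [← Module.finrank_eq_rank, finrank_euclideanSpace_fin]
  refine (singularNumber_le hr).trans ?_
  rw [← ContinuousLinearMap.rTensor_sub]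
  exact ContinuousLinearMap.norm_rTensor_le _ _

theorem norm_mul_mul_le_of_norm_le_one {a b d : H →L[ℂ] H}
    (ha : ‖a‖ ≤ 1) (hd : ‖d‖ ≤ 1) : ‖a * b * d‖ ≤ ‖b‖ :=
  calc ‖a * b * d‖ ≤ ‖a * b‖ * ‖d‖ := norm_mul_le _ _
    _ ≤ ‖a * b‖ * 1 := by gcongr
    _ ≤ ‖a‖ * ‖b‖ * 1 := by gcongr; exact norm_mul_le _ _
    _ ≤ 1 * ‖b‖ * 1 := by gcongr
    _ = ‖b‖ := by ring

theorem Orthonormal.norm_sum_smul_sq {ι : Type*} {e : ι → H} (he : Orthonormal ℂ e)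
    (A : Finset ι) (c : ι → ℂ) : ‖∑ i ∈ A, c i • e i‖ ^ 2 = ∑ i ∈ A, ‖c i‖ ^ 2 := by
  rw [← inner_self_eq_norm_sq (𝕜 := ℂ), he.inner_sum]
  simp [Complex.conj_mul', ← Complex.ofReal_pow]

/-- The singular values of an operator dominate the moduli of its diagonal, for an operator that
is diagonal on an orthonormal family. -/
theorem le_singularNumber_of_diagonal {ι H : Type} [NormedAddCommGroup H] [InnerProductSpace ℂ H]
    {e : ι → H} (he : Orthonormal ℂ e) {d : ι → ℂ} {T : H →L[ℂ] H}
    (hT : ∀ i, T (e i) = d i • e i) {A : Finset ι} {n : ℕ} (hA : n < A.card) {r : ℝ} (hr : 0 ≤ r)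
    (hd : ∀ i ∈ A, r ≤ ‖d i‖) : r ≤ singularNumber T n := by
  refine le_singularNumber fun F hF => ?_
  -- The span of more than `n` basis vectors meets the kernel of a rank-`n` operator `F`; on a
  -- vector there `T - F` agrees with `T`, which stretches by at least `r`.
  let L : (A → ℂ) →ₗ[ℂ] H := Fintype.linearCombination ℂ (fun i : A => e i)
  have hinj : ¬ Function.Injective ((F : H →ₗ[ℂ] H) ∘ₗ L) := by
    intro hi
    have h1 := rank_range_of_injective _ hi
    have h2 := (LinearMap.rank_comp_le_left L (F : H →ₗ[ℂ] H)).trans hF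
    rw [LinearMap.rank, h1, rank_fun'] at h2
    simp at h2
    omega
  rw [← LinearMap.ker_eq_bot] at hinj
  obtain ⟨c, hc, hc0⟩ := Submodule.exists_mem_ne_zero_of_ne_bot hinj
  have heA : Orthonormal ℂ (fun i : A => e i) := he.comp _ Subtype.val_injective
  have hL : L c = ∑ i, c i • e i := by simp [L, Fintype.linearCombination_apply]
  have hTL : (T - F) (L c) = ∑ i : A, (c i * d i) • e i := by
    have : F (L c) = 0 := hc
    rw [sub_apply, this, sub_zero, hL]
    simp [hT, smul_smul]
  have hn1 : ‖L c‖ ^ 2 = ∑ i, ‖c i‖ ^ 2 := by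
    rw [hL]; exact heA.norm_sum_smul_sq Finset.univ c
  have hn2 : ‖(T - F) (L c)‖ ^ 2 = ∑ i : A, ‖c i * d i‖ ^ 2 := by
    rw [hTL]; exact heA.norm_sum_smul_sq Finset.univ (fun i => c i * d i)
  have hpos : 0 < ‖L c‖ ^ 2 := by
    rw [hn1]
    obtain ⟨i, hi⟩ := Function.ne_iff.1 hc0
    exact Finset.sum_pos' (fun _ _ => by positivity)
      ⟨i, Finset.mem_univ _, pow_pos (norm_pos_iff.2 hi) 2⟩
  have h1 : (r * ‖L c‖) ^ 2 ≤ ‖(T - F) (L c)‖ ^ 2 := by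
    rw [mul_pow, hn1, hn2, Finset.mul_sum]
    refine Finset.sum_le_sum fun i _ => ?_
    rw [norm_mul, mul_pow, mul_comm]
    gcongr
    exact hd i i.2
  have h2 : r * ‖L c‖ ≤ ‖T - F‖ * ‖L c‖ :=
    (abs_le_of_sq_le_sq' h1 (norm_nonneg _)).2.trans ((T - F).le_opNorm _)
  exact le_of_mul_le_mul_right h2 (by by_contra h; simp_all)

theorem IsSchatten.summable_diagonal {ι H : Type} [NormedAddCommGroup H] [InnerProductSpace ℂ H]
    {e : ι → H} (he : Orthonormal ℂ e) {d : ι → ℂ} {T : H →L[ℂ] H}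
    (hT : ∀ i, T (e i) = d i • e i) {p : ℝ} (hp : 0 < p) (hS : IsSchatten p T) :
    Summable fun i => ‖d i‖ ^ p := by
  classical
  have key : ∀ n : ℕ, ∀ A : Finset ι, A.card = n →
      ∑ i ∈ A, ‖d i‖ ^ p ≤ ∑ j ∈ Finset.range n, singularNumber T j ^ p := by
    intro n
    induction n with
    | zero => intro A hA; simp [Finset.card_eq_zero.1 hA]
    | succ n ih =>
      intro A hA
      -- All `n + 1` entries over `A` are at least the smallest one, so the smallest is at most the
      -- `n`-th singular number; the others go to the induction hypothesis.
      obtain ⟨i, hi, hmin⟩ := Finset.exists_min_image A (fun i => ‖d i‖)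
        (Finset.card_pos.1 (by omega))
      rw [← Finset.sum_erase_add _ _ hi, Finset.sum_range_succ]
      refine add_le_add (ih _ (by rw [Finset.card_erase_of_mem hi]; omega)) ?_
      exact Real.rpow_le_rpow (norm_nonneg _)
        (le_singularNumber_of_diagonal he hT (A := A) (by omega) (norm_nonneg _) hmin) hp.le
  refine summable_of_sum_le (c := ∑' j, singularNumber T j ^ p)
    (fun i => Real.rpow_nonneg (norm_nonneg _) _) fun A => (key _ A rfl).trans ?_
  exact hS.sum_le_tsum _ fun j _ => Real.rpow_nonneg (singularNumber_nonneg _ _) _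

/-- An operator that is approximated by finite-rank operators at the rate of decay of a
`p`-summable family belongs to the Schatten `p`-class. -/
theorem isSchatten_of_forall_finset {ι : Type*} {a : ι → ℝ} (ha : ∀ i, 0 ≤ a i) {p : ℝ}
    (hp : 0 < p) (hs : Summable fun i => a i ^ p) {R : H →L[ℂ] K} {k : ℕ} (hk : k ≠ 0)
    (h : ∀ (A : Finset ι) (c : ℝ), 0 ≤ c → (∀ i ∉ A, a i ≤ c) →
      singularNumber R (k * A.card) ≤ c) : IsSchatten p R := by
  classical
  refine isSchatten_of_summable_mul hp hk ?_
  -- Greedy matching of each nonzero `s_{kj}` with a fresh index `i` satisfying `s_{kj} < 2 a i`. If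
  -- no index outside `A` worked, the hypothesis with `c = s_{kn} / 2` would give `s_{kn} ≤ s_{kn} /
  -- 2`.
  have key : ∀ n : ℕ, ∃ A : Finset ι, A.card ≤ n ∧
      ∑ j ∈ Finset.range n, singularNumber R (k * j) ^ p ≤ ∑ i ∈ A, (2 * a i) ^ p := by
    intro n
    induction n with
    | zero => exact ⟨∅, by simp⟩
    | succ n ih =>
      obtain ⟨A, hA, hle⟩ := ih
      by_cases h0 : singularNumber R (k * n) = 0
      · refine ⟨A, by omega, ?_⟩
        rw [Finset.sum_range_succ, h0, Real.zero_rpow hp.ne', add_zero]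
        exact hle
      have hpos : 0 < singularNumber R (k * n) :=
        lt_of_le_of_ne (singularNumber_nonneg _ _) (Ne.symm h0)
      have hex : ∃ i ∉ A, singularNumber R (k * n) / 2 < a i := by
        by_contra! hcon
        have h1 := h A _ (by positivity) hcon
        have h2 := singularNumber_antitone R (Nat.mul_le_mul_left k hA)
        linarith
      obtain ⟨i, hi, hai⟩ := hex
      refine ⟨insert i A, (Finset.card_insert_le _ _).trans (by omega), ?_⟩
      rw [Finset.sum_range_succ, Finset.sum_insert hi, add_comm]
      refine add_le_add (Real.rpow_le_rpow hpos.le (by linarith) hp.le) hle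
  have hs' : Summable fun i => (2 * a i) ^ p := by
    simp_rw [fun i => Real.mul_rpow (x := 2) (z := p) zero_le_two (ha i)]
    exact hs.mul_left _
  have hnn : ∀ i, 0 ≤ (2 * a i) ^ p := fun i =>
    Real.rpow_nonneg (mul_nonneg zero_le_two (ha i)) _
  refine summable_of_sum_range_le (c := ∑' i, (2 * a i) ^ p)
    (fun n => Real.rpow_nonneg (singularNumber_nonneg _ _) _) fun n => ?_
  obtain ⟨A, -, hA⟩ := key n
  exact hA.trans (hs'.sum_le_tsum _ fun i _ => hnn i)

end SchattenLemmas

/-! ### Multi-indices: stabilization and summation over slabs. -/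

section Multiindices

variable {m : ℕ}

theorem MultiIndex.sub_add_single {α : MultiIndex m} {i : Fin m} (h : α i ≠ 0) :
    α - Pi.single i 1 + Pi.single i 1 = α := by
  funext j
  by_cases hj : j = i
  · subst hj
    simp
    omega
  · simp [hj]

/-- A monotone family of subspaces of a finite-dimensional space indexed by the multi-indices is
eventually constant in each coordinate, uniformly in the others. -/
theorem Monotone.exists_stable_multiIndex {V : Type*} [AddCommGroup V] [Module ℂ V]
    [FiniteDimensional ℂ V] {E : MultiIndex m → Submodule ℂ V} (hE : Monotone E) :
    ∃ ν : MultiIndex m, ∀ (α : MultiIndex m) (i : Fin m), ν i ≤ α i →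
      E (α + Pi.single i 1) = E α := by
  -- The minimal places where the dimension reaches `d` form an antichain, hence a finite set by
  -- Dickson's lemma; `ν` bounds them for all `d ≤ dim V`.
  let U : ℕ → Set (MultiIndex m) := fun d =>
    {α | Minimal (fun β => d ≤ Module.finrank ℂ (E β)) α}
  have hfin : ∀ d, (U d).Finite := fun d =>
    WellQuasiOrderedLE.finite_of_isAntichain (setOfPred_minimal_antichain _)
  have hfin' : (⋃ d ∈ Finset.range (Module.finrank ℂ V + 1), U d).Finite :=
    Set.Finite.biUnion (Finset.finite_toSet _) fun d _ => hfin d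
  obtain ⟨ν, hν⟩ := hfin'.bddAbove
  refine ⟨ν, fun α i hi => ?_⟩
  have hle : α ≤ α + Pi.single i 1 := le_self_add
  refine (Submodule.eq_of_le_of_finrank_le (hE hle) ?_).symm
  -- The dimension at `α + e_i` is already reached at a minimal `μ ≤ α + e_i`. Since `μ i ≤ ν i ≤ α
  -- i`, in fact `μ ≤ α`, so nothing is gained from `α` to `α + e_i`.
  obtain ⟨μ, hμ, hmin⟩ := exists_minimal_le_of_wellFoundedLT
    (fun β => Module.finrank ℂ (E (α + Pi.single i 1)) ≤ Module.finrank ℂ (E β)) _ le_rfl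
  have hμν : μ ≤ ν := hν (Set.mem_biUnion (Finset.mem_coe.2 (Finset.mem_range.2
    (Nat.lt_succ_of_le (Submodule.finrank_le _)))) hmin)
  refine hmin.1.trans (Submodule.finrank_mono (hE fun j => ?_))
  by_cases hj : j = i
  · subst hj
    exact (hμν j).trans hi
  · simpa [hj] using hμ j

/-- Induction on the thickness `N` of the slab: `a` is dominated by `d` plus the translate by `e_i`
of `a` on the thinner slab, and translation preserves summability. -/
theorem summable_rpow_of_increment {a d : MultiIndex m → ℝ} {i : Fin m} {p : ℝ} (hp : 0 < p)
    (ha : ∀ α, 0 ≤ a α) (hd : ∀ α, 0 ≤ d α) (h0 : ∀ α, α i = 0 → a α ≤ d α)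
    (hs : ∀ α, a (α + Pi.single i 1) ≤ d (α + Pi.single i 1) + a α)
    (hsum : Summable fun α => d α ^ p) (N : ℕ) :
    Summable fun α => (if α i < N then a α else 0) ^ p := by
  induction N with
  | zero => simp [Real.zero_rpow hp.ne', summable_zero]
  | succ N ih =>
    let F : MultiIndex m → ℝ := fun α => if α i < N then a α else 0
    let G : MultiIndex m → ℝ := fun α => if α i = 0 then 0 else F (α - Pi.single i 1)
    have hF : ∀ α, 0 ≤ F α := fun α => by dsimp only [F]; split_ifs; exacts [ha α, le_rfl]
    have hG : ∀ α, 0 ≤ G α := fun α => by dsimp only [G]; split_ifs; exacts [le_rfl, hF _]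
    have hinj : Function.Injective fun α : MultiIndex m => α + Pi.single i 1 :=
      add_left_injective _
    have hGs : Summable fun α => G α ^ p := by
      refine (hinj.summable_iff ?_).1 (ih.congr fun α => ?_)
      · intro β hβ
        have : β i = 0 := by
          by_contra h
          exact hβ ⟨_, MultiIndex.sub_add_single h⟩
        simp [G, this, Real.zero_rpow hp.ne']
      · simp [G, F]
    refine Summable.of_nonneg_of_le (fun α => Real.rpow_nonneg ?_ _) (fun α => ?_)
      ((hsum.add hGs).mul_left (2 ^ p))
    · split_ifs; exacts [ha α, le_rfl]
    · refine le_trans (Real.rpow_le_rpow ?_ ?_ hp.le)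
        (add_rpow_le_two_rpow_mul (hd α) (hG α) hp.le)
      · split_ifs; exacts [ha α, le_rfl]
      · split_ifs with h
        · by_cases hα : α i = 0
          · simpa [G, hα] using h0 α hα
          · have h1 := hs (α - Pi.single i 1)
            rw [MultiIndex.sub_add_single hα] at h1
            have h2 : G α = a (α - Pi.single i 1) := by
              have : (α - Pi.single i 1 : MultiIndex m) i < N := by simp; omega
              simp only [G, F, hα, if_false, this, if_true]
            rwa [h2]
        · exact add_nonneg (hd α) (hG α)

end Multiindices

/-! ### Coordinate operators on `M_Λ`: cutoffs, adjoints and the diagonal self-commutator. -/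

namespace WeightSet

variable {m : ℕ} (Λ : WeightSet m)

/-- The ratio `‖Z_i Z^α‖² / ‖Z^α‖²`. -/
noncomputable def sqRatio (i : Fin m) (α : MultiIndex m) : ℝ :=
  (Λ.weight (α + Pi.single i 1) / Λ.weight α) ^ 2

theorem sqRatio_nonneg (i : Fin m) (α : MultiIndex m) : 0 ≤ Λ.sqRatio i α := sq_nonneg _

theorem hasSum_norm_sq (f : Λ.Space) : HasSum (fun α => ‖f α‖ ^ 2) (‖f‖ ^ 2) := by
  simpa using lp.hasSum_norm (p := 2) (by simp) f

theorem norm_coordOp_sq (hΛ : Λ.IsDecreasing) (i : Fin m) (f : Λ.Space) :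
    HasSum (fun α => Λ.sqRatio i α * ‖f α‖ ^ 2) (‖Λ.coordOp hΛ i f‖ ^ 2) := by
  have hinj : Function.Injective fun α : MultiIndex m => α + Pi.single i 1 :=
    add_left_injective _
  have h := Λ.hasSum_norm_sq (Λ.coordOp hΛ i f)
  refine ((hinj.hasSum_iff ?_).2 h).congr_fun ?_
  · intro β hβ
    have : β i = 0 := by
      by_contra h
      exact hβ ⟨_, MultiIndex.sub_add_single h⟩
    change ‖Λ.coordFun i f β‖ ^ 2 = 0
    simp [coordFun, this]
  · intro α
    change _ = ‖Λ.coordFun i f (α + Pi.single i 1)‖ ^ 2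
    rw [coordFun_add_single, norm_mul, Complex.norm_real, mul_pow, Real.norm_eq_abs, sq_abs]
    rfl

/-- The projection of `M_Λ` onto the closed span of the `Z^α`, `α ∈ X`. -/
noncomputable def cutoff (X : Set (MultiIndex m)) : Λ.Space →L[ℂ] Λ.Space :=
  LinearMap.mkContinuous
    { toFun := fun f => ⟨X.indicator f, memℓp_gen <| by
        refine (lp.memℓp f).summable (by simp) |>.of_nonneg_of_le (fun _ => by positivity)
          fun α => ?_
        exact Real.rpow_le_rpow (norm_nonneg _) (norm_indicator_le_norm_self _ _) (by simp)⟩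
      map_add' := fun f g => by
        ext β
        exact congrFun (Set.indicator_add X f g) β
      map_smul' := fun c f => by
        ext β
        exact congrFun (Set.indicator_const_smul X c f) β }
    1 fun f => by
      rw [one_mul]
      refine lp.norm_le_of_tsum_le (by simp) (norm_nonneg f) ?_
      rw [lp.norm_rpow_eq_tsum (by simp)]
      have hf := (lp.memℓp f).summable (by simp : 0 < (2 : ENNReal).toReal)
      have hle : ∀ α, ‖X.indicator f α‖ ^ (2 : ENNReal).toReal ≤ ‖f α‖ ^ (2 : ENNReal).toReal :=
        fun α => Real.rpow_le_rpow (norm_nonneg _) (norm_indicator_le_norm_self _ _) (by simp)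
      exact (hf.of_nonneg_of_le (fun _ => by positivity) hle).tsum_le_tsum hle hf

theorem cutoff_apply (X : Set (MultiIndex m)) (f : Λ.Space) (α : MultiIndex m) :
    Λ.cutoff X f α = X.indicator f α := rfl

theorem cutoff_monomial_of_mem {X : Set (MultiIndex m)} {α : MultiIndex m} (h : α ∈ X) :
    Λ.cutoff X (Λ.monomial α) = Λ.monomial α := by
  ext β
  rw [cutoff_apply]
  by_cases hβ : β ∈ X
  · rw [Set.indicator_of_mem hβ]
  · rw [Set.indicator_of_notMem hβ, monomial, lp.single_apply_ne]
    rintro rfl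
    exact hβ h

theorem cutoff_monomial_of_notMem {X : Set (MultiIndex m)} {α : MultiIndex m} (h : α ∉ X) :
    Λ.cutoff X (Λ.monomial α) = 0 := by
  ext β
  rw [cutoff_apply]
  by_cases hβ : β ∈ X
  · rw [Set.indicator_of_mem hβ, monomial, lp.single_apply_ne]
    · rfl
    rintro rfl
    exact h hβ
  · rw [Set.indicator_of_notMem hβ]
    rfl

theorem cutoff_mul (X Y : Set (MultiIndex m)) :
    Λ.cutoff X * Λ.cutoff Y = Λ.cutoff (X ∩ Y) := by
  ext f β
  change X.indicator (Y.indicator f) β = (X ∩ Y).indicator f β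
  rw [Set.indicator_indicator]

theorem cutoff_add_cutoff_compl (X : Set (MultiIndex m)) :
    Λ.cutoff X + Λ.cutoff Xᶜ = 1 := by
  ext f β
  change X.indicator f β + Xᶜ.indicator f β = f β
  exact congrFun (Set.indicator_self_add_compl X f) β

theorem cutoff_mul_coordOp (hΛ : Λ.IsDecreasing) (X : Set (MultiIndex m)) (i : Fin m) :
    Λ.cutoff X * Λ.coordOp hΛ i = Λ.coordOp hΛ i * Λ.cutoff {α | α + Pi.single i 1 ∈ X} := by
  classical
  ext f β
  change X.indicator (Λ.coordFun i f) β =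
    Λ.coordFun i (Set.indicator {α | α + Pi.single i 1 ∈ X} f) β
  by_cases h : β i = 0
  · simp [coordFun, Set.indicator_apply, h]
  · simp [coordFun, Set.indicator_apply, h, MultiIndex.sub_add_single h]

theorem adjoint_cutoff (X : Set (MultiIndex m)) :
    ContinuousLinearMap.adjoint (Λ.cutoff X) = Λ.cutoff X := by
  classical
  symm
  rw [ContinuousLinearMap.eq_adjoint_iff]
  intro f g
  rw [lp.inner_eq_tsum, lp.inner_eq_tsum]
  refine tsum_congr fun α => ?_
  rw [cutoff_apply, cutoff_apply]
  by_cases h : α ∈ X <;> simp [h]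

theorem rank_cutoff_le (A : Finset (MultiIndex m)) :
    LinearMap.rank (Λ.cutoff A).toLinearMap ≤ (A.card : Cardinal) := by
  let L : (A → ℂ) →ₗ[ℂ] Λ.Space :=
    Fintype.linearCombination ℂ fun a : A => (lp.single 2 (a : MultiIndex m) (1 : ℂ) : Λ.Space)
  let R : Λ.Space →ₗ[ℂ] (A → ℂ) :=
    { toFun := fun f a => f a, map_add' := fun _ _ => rfl, map_smul' := fun _ _ => rfl }
  have h : (Λ.cutoff A).toLinearMap = L ∘ₗ R := by
    ext f β
    change Set.indicator _ f β = (L (R f)) β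
    simp only [L, Fintype.linearCombination_apply, lp.coeFn_sum, Finset.sum_apply,
      lp.coeFn_smul, Pi.smul_apply, smul_eq_mul]
    change _ = ∑ a : A, f a * (lp.single 2 (a : MultiIndex m) (1 : ℂ) : Λ.Space) β
    rw [Finset.sum_coe_sort A fun a => f a * (lp.single 2 a (1 : ℂ) : Λ.Space) β]
    simp [lp.single_apply, Pi.single_apply, Set.indicator_apply]
  rw [h]
  refine (LinearMap.rank_comp_le_left _ _).trans ((LinearMap.rank_le_domain _).trans ?_)
  simp

theorem norm_coordOp_mul_cutoff_le (hΛ : Λ.IsDecreasing) {X : Set (MultiIndex m)} {i : Fin m}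
    {c : ℝ} (hX : ∀ α ∈ X, Λ.sqRatio i α ≤ c) (hc : 0 ≤ c) :
    ‖Λ.coordOp hΛ i * Λ.cutoff X‖ ≤ √c := by
  classical
  refine ContinuousLinearMap.opNorm_le_bound _ (Real.sqrt_nonneg c) fun f => ?_
  refine (sq_le_sq₀ (norm_nonneg _) (by positivity)).1 ?_
  rw [mul_pow, Real.sq_sqrt hc]
  refine hasSum_le (fun α => ?_) (Λ.norm_coordOp_sq hΛ i (Λ.cutoff X f))
    ((Λ.hasSum_norm_sq f).mul_left c)
  rw [cutoff_apply]
  by_cases h : α ∈ X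
  · rw [Set.indicator_of_mem h]
    gcongr
    exact hX α h
  · rw [Set.indicator_of_notMem h]
    simp
    positivity

theorem adjoint_coordOp_monomial_of_eq_zero (hΛ : Λ.IsDecreasing) {i : Fin m} {α : MultiIndex m}
    (h : α i = 0) : ContinuousLinearMap.adjoint (Λ.coordOp hΛ i) (Λ.monomial α) = 0 := by
  refine ext_inner_right ℂ fun g => ?_
  rw [ContinuousLinearMap.adjoint_inner_left, monomial, lp.inner_single_left, inner_zero_left]
  change inner ℂ _ (Λ.coordFun i g α) = 0
  simp [coordFun, h]

theorem adjoint_coordOp_monomial (hΛ : Λ.IsDecreasing) (i : Fin m) (α : MultiIndex m) :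
    ContinuousLinearMap.adjoint (Λ.coordOp hΛ i) (Λ.monomial (α + Pi.single i 1)) =
      (Λ.sqRatio i α : ℂ) • Λ.monomial α := by
  refine ext_inner_right ℂ fun g => ?_
  rw [ContinuousLinearMap.adjoint_inner_left, monomial, lp.inner_single_left, inner_smul_left,
    monomial, lp.inner_single_left]
  change inner ℂ _ (Λ.coordFun i g _) = _
  have hα : (Λ.weight α : ℂ) ≠ 0 := by exact_mod_cast (Λ.weight_pos α).ne'
  rw [coordFun_add_single]
  simp [sqRatio]
  field_simp

/-- The diagonal of the self-commutator `[Z_i, Z_i^*]`. -/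
noncomputable def selfCommDiag (i : Fin m) (α : MultiIndex m) : ℝ :=
  (if α i = 0 then 0 else Λ.sqRatio i (α - Pi.single i 1)) - Λ.sqRatio i α

theorem crossCommutator_self_monomial (hΛ : Λ.IsDecreasing) (i : Fin m) (α : MultiIndex m) :
    crossCommutator (Λ.coordOp hΛ i) (Λ.coordOp hΛ i) (Λ.monomial α) =
      (Λ.selfCommDiag i α : ℂ) • Λ.monomial α := by
  rw [crossCommutator, sub_apply, mul_apply_eq_comp, mul_apply_eq_comp,
    coordOp_monomial, adjoint_coordOp_monomial, selfCommDiag]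
  split_ifs with h
  · rw [adjoint_coordOp_monomial_of_eq_zero _ _ h]
    simp
  · obtain ⟨β, rfl⟩ : ∃ β : MultiIndex m, α = β + Pi.single i 1 :=
      ⟨_, (MultiIndex.sub_add_single h).symm⟩
    rw [adjoint_coordOp_monomial, map_smul, coordOp_monomial, ← sub_smul]
    simp

theorem orthonormal_single :
    Orthonormal ℂ fun α : MultiIndex m => (lp.single 2 α (1 : ℂ) : Λ.Space) := by
  rw [orthonormal_iff_ite]
  intro α β
  rw [lp.inner_single_left, lp.single_apply]
  by_cases h : α = β
  · subst h; simp
  · simp [h]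

theorem single_eq_smul_monomial (α : MultiIndex m) :
    (lp.single 2 α (1 : ℂ) : Λ.Space) = (Λ.weight α : ℂ)⁻¹ • Λ.monomial α := by
  have hα : (Λ.weight α : ℂ) ≠ 0 := by exact_mod_cast (Λ.weight_pos α).ne'
  rw [monomial, ← lp.single_smul]
  simp [hα]

/-- Telescoping along direction `i`: the self-commutator entry is `-r_i(α)` on the face `α_i = 0`
and the successive difference of `r_i` elsewhere. -/
theorem summable_sqRatio (hΛ : Λ.IsDecreasing) {p : ℝ} (hp : 0 < p) {i : Fin m}
    (h : IsSchatten p (crossCommutator (Λ.coordOp hΛ i) (Λ.coordOp hΛ i))) (N : ℕ) :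
    Summable fun α => (if α i < N then Λ.sqRatio i α else 0) ^ p := by
  refine summable_rpow_of_increment (d := fun α => |Λ.selfCommDiag i α|) hp
    (Λ.sqRatio_nonneg i) (fun _ => abs_nonneg _) (fun α hα => ?_) (fun α => ?_) ?_ N
  · simp [selfCommDiag, hα, le_abs_self]
  · have := neg_abs_le (Λ.selfCommDiag i (α + Pi.single i 1))
    simp only [selfCommDiag, Pi.add_apply, Pi.single_eq_same, Nat.add_eq_zero_iff, one_ne_zero,
      and_false, if_false, add_tsub_cancel_right] at this ⊢
    linarith
  · refine (h.summable_diagonal orthonormal_single (d := fun α => (Λ.selfCommDiag i α : ℂ))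
      (fun α => ?_) hp).congr fun α => by simp
    rw [single_eq_smul_monomial, map_smul, crossCommutator_self_monomial, smul_comm]

end WeightSet

/-! ### The monomial submodule, its fibers and its off-diagonal corners. -/

namespace WeightSet

variable {m : ℕ} (Λ : WeightSet m) (hΛ : Λ.IsDecreasing) {k : ℕ}
  (C : Set (MultiIndex m × EuclideanSpace ℂ (Fin k)))

/-- The subspace of the `x ∈ ℂᵏ` for which `Z^α ⊗ x` lies in the submodule generated by `C`. -/
noncomputable def fiber (C : Set (MultiIndex m × EuclideanSpace ℂ (Fin k))) (α : MultiIndex m) :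
    Submodule ℂ (EuclideanSpace ℂ (Fin k)) :=
  Submodule.span ℂ {x | ∃ β ≤ α, (β, x) ∈ C}

theorem fiber_mono : Monotone (fiber C) := fun _ _ h =>
  Submodule.span_mono fun _ ⟨β, hβ, hx⟩ => ⟨β, hβ.trans h, hx⟩

variable {C} in
theorem monomialSubmodule_le
    {N : Submodule ℂ (Λ.Space ⊗[ℂ] EuclideanSpace ℂ (Fin k))}
    (hcl : IsClosed (N : Set (Λ.Space ⊗[ℂ] EuclideanSpace ℂ (Fin k))))
    (hinv : ∀ i, ∀ v ∈ N, Λ.coordOpTensor hΛ k i v ∈ N)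
    (hgen : ∀ a ∈ C, Λ.monomial a.1 ⊗ₜ[ℂ] a.2 ∈ N) :
    (Λ.monomialSubmodule hΛ k C).toSubmodule ≤ N :=
  sInf_le ⟨hcl, hinv, by rintro _ ⟨a, ha, rfl⟩; exact hgen a ha⟩

theorem coordOpTensor_tmul (i : Fin m) (f : Λ.Space) (x : EuclideanSpace ℂ (Fin k)) :
    Λ.coordOpTensor hΛ k i (f ⊗ₜ x) = Λ.coordOp hΛ i f ⊗ₜ x := rfl

theorem generator_mem {a : MultiIndex m × EuclideanSpace ℂ (Fin k)} (ha : a ∈ C) :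
    Λ.monomial a.1 ⊗ₜ[ℂ] a.2 ∈ (Λ.monomialSubmodule hΛ k C).toSubmodule :=
  Submodule.mem_sInf.2 fun _ hN => hN.2.2 ⟨a, ha, rfl⟩

variable {C} in
theorem monomial_add_tmul_mem {β : MultiIndex m} {x : EuclideanSpace ℂ (Fin k)}
    (h : (β, x) ∈ C) (γ : MultiIndex m) :
    Λ.monomial (β + γ) ⊗ₜ[ℂ] x ∈ (Λ.monomialSubmodule hΛ k C).toSubmodule := by
  induction hn : ∑ i, γ i generalizing γ with
  | zero =>
    have : γ = 0 := by
      funext i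
      exact (Finset.sum_eq_zero_iff.1 hn) i (Finset.mem_univ i)
    rw [this, add_zero]
    exact Λ.generator_mem hΛ C h
  | succ n ih =>
    obtain ⟨i, -, hi⟩ : ∃ i ∈ Finset.univ, γ i ≠ 0 :=
      Finset.exists_ne_zero_of_sum_ne_zero (by omega)
    obtain ⟨δ, rfl⟩ : ∃ δ : MultiIndex m, γ = δ + Pi.single i 1 :=
      ⟨_, (MultiIndex.sub_add_single hi).symm⟩
    have h1 := ih δ (by simpa [Finset.sum_add_distrib, Finset.sum_pi_single'] using hn)
    have h2 := (Λ.monomialSubmodule hΛ k C).map_mem' i _ h1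
    rwa [coordOpTensor_tmul, coordOp_monomial, add_assoc] at h2

variable {C} in
theorem monomial_tmul_mem {α : MultiIndex m} {x : EuclideanSpace ℂ (Fin k)}
    (h : x ∈ fiber C α) :
    Λ.monomial α ⊗ₜ[ℂ] x ∈ (Λ.monomialSubmodule hΛ k C).toSubmodule := by
  have : fiber C α ≤ (Λ.monomialSubmodule hΛ k C).toSubmodule.comap
      (TensorProduct.mk ℂ Λ.Space (EuclideanSpace ℂ (Fin k)) (Λ.monomial α)) := by
    refine Submodule.span_le.2 ?_
    rintro x ⟨β, hβ, hx⟩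
    obtain ⟨γ, rfl⟩ := exists_add_of_le hβ
    exact Λ.monomial_add_tmul_mem hΛ hx γ
  exact this h

variable {C} in
-- The span of these test vectors is invariant because the fibers increase, and it contains the
-- generators; hence its closure contains the whole submodule.
theorem mem_orthogonal_of_forall_monomial {w : Λ.Space ⊗[ℂ] EuclideanSpace ℂ (Fin k)}
    (h : ∀ α, ∀ x ∈ fiber C α, inner ℂ (Λ.monomial α ⊗ₜ[ℂ] x) w = 0) :
    w ∈ (Λ.monomialSubmodule hΛ k C).toSubmoduleᗮ := by
  let G : Submodule ℂ (Λ.Space ⊗[ℂ] EuclideanSpace ℂ (Fin k)) :=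
    Submodule.span ℂ {v | ∃ α, ∃ x ∈ fiber C α, v = Λ.monomial α ⊗ₜ[ℂ] x}
  have hle : (Λ.monomialSubmodule hΛ k C).toSubmodule ≤ G.topologicalClosure := by
    refine Λ.monomialSubmodule_le hΛ G.isClosed_topologicalClosure (fun i v hv => ?_) ?_
    · have hG : G ≤ G.comap (Λ.coordOpTensor hΛ k i).toLinearMap := by
        refine Submodule.span_le.2 ?_
        rintro _ ⟨α, x, hx, rfl⟩
        refine Submodule.subset_span ⟨α + Pi.single i 1, x, fiber_mono C le_self_add hx, ?_⟩
        exact congrArg (· ⊗ₜ[ℂ] x) (Λ.coordOp_monomial hΛ i α)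
      exact map_mem_closure (Λ.coordOpTensor hΛ k i).continuous hv hG
    · intro a ha
      exact G.le_topologicalClosure
        (Submodule.subset_span ⟨a.1, a.2, Submodule.subset_span ⟨a.1, le_rfl, ha⟩, rfl⟩)
  refine Submodule.orthogonal_le hle ?_
  rw [Submodule.orthogonal_closure]
  intro u hu
  induction hu using Submodule.span_induction with
  | mem u hu => obtain ⟨α, x, hx, rfl⟩ := hu; exact h α x hx
  | zero => simp
  | add u v _ _ hu hv => rw [inner_add_left, hu, hv, add_zero]
  | smul c u _ hu => rw [inner_smul_left, hu, mul_zero]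

/-- The projection of `M_Λ ⊗ ℂᵏ` onto the closed span of the `Z^α ⊗ x`, `α ∈ X`. -/
noncomputable def cutoffTensor (k : ℕ) (X : Set (MultiIndex m)) :
    Λ.Space ⊗[ℂ] EuclideanSpace ℂ (Fin k) →L[ℂ] Λ.Space ⊗[ℂ] EuclideanSpace ℂ (Fin k) :=
  (Λ.cutoff X).rTensor (EuclideanSpace ℂ (Fin k))

theorem adjoint_cutoffTensor (X : Set (MultiIndex m)) :
    ContinuousLinearMap.adjoint (Λ.cutoffTensor k X) = Λ.cutoffTensor k X := by
  rw [cutoffTensor, ContinuousLinearMap.adjoint_rTensor, adjoint_cutoff]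

theorem cutoffTensor_mul (X Y : Set (MultiIndex m)) :
    Λ.cutoffTensor k X * Λ.cutoffTensor k Y = Λ.cutoffTensor k (X ∩ Y) := by
  simp only [cutoffTensor]
  rw [← ContinuousLinearMap.rTensor_mul, cutoff_mul]

theorem cutoffTensor_add_compl (X : Set (MultiIndex m)) :
    Λ.cutoffTensor k X + Λ.cutoffTensor k Xᶜ = 1 := by
  simp only [cutoffTensor]
  rw [← ContinuousLinearMap.rTensor_add, cutoff_add_cutoff_compl,
    ContinuousLinearMap.rTensor_one]

theorem rank_cutoffTensor_le (A : Finset (MultiIndex m)) :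
    LinearMap.rank (Λ.cutoffTensor k A).toLinearMap ≤ ((k * A.card : ℕ) : Cardinal) := by
  refine (LinearMap.rank_rTensor_le (Λ.cutoff A).toLinearMap _).trans ?_
  rw [mul_comm k, Nat.cast_mul]
  refine mul_le_mul' (Λ.rank_cutoff_le A) (le_of_eq ?_)
  rw [← Module.finrank_eq_rank, finrank_euclideanSpace_fin]

theorem norm_coordOpTensor_mul_cutoffTensor_le {X : Set (MultiIndex m)} {i : Fin m} {c : ℝ}
    (hX : ∀ α ∈ X, Λ.sqRatio i α ≤ c) (hc : 0 ≤ c) :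
    ‖Λ.coordOpTensor hΛ k i * Λ.cutoffTensor k X‖ ≤ √c := by
  rw [coordOpTensor, cutoffTensor, ← ContinuousLinearMap.rTensor_mul]
  exact (ContinuousLinearMap.norm_rTensor_le _ _).trans
    (Λ.norm_coordOp_mul_cutoff_le hΛ hX hc)

theorem cutoffTensor_coordOpTensor (X : Set (MultiIndex m)) (i : Fin m)
    (v : Λ.Space ⊗[ℂ] EuclideanSpace ℂ (Fin k)) :
    Λ.cutoffTensor k X (Λ.coordOpTensor hΛ k i v) =
      Λ.coordOpTensor hΛ k i (Λ.cutoffTensor k {α | α + Pi.single i 1 ∈ X} v) := by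
  have h : Λ.cutoffTensor k X * Λ.coordOpTensor hΛ k i =
      Λ.coordOpTensor hΛ k i * Λ.cutoffTensor k {α | α + Pi.single i 1 ∈ X} := by
    simp only [cutoffTensor, coordOpTensor]
    rw [← ContinuousLinearMap.rTensor_mul, ← ContinuousLinearMap.rTensor_mul, cutoff_mul_coordOp]
  exact congrArg (· v) h

variable {C} in
theorem cutoffTensor_mem (X : Set (MultiIndex m))
    {v : Λ.Space ⊗[ℂ] EuclideanSpace ℂ (Fin k)}
    (hv : v ∈ (Λ.monomialSubmodule hΛ k C).toSubmodule) :
    Λ.cutoffTensor k X v ∈ (Λ.monomialSubmodule hΛ k C).toSubmodule := by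
  -- All sets `X` are needed at once for invariance: moving a cutoff past `T_i` replaces `X` by its
  -- translate.
  let N : Submodule ℂ (Λ.Space ⊗[ℂ] EuclideanSpace ℂ (Fin k)) :=
    ⨅ X, (Λ.monomialSubmodule hΛ k C).toSubmodule.comap (Λ.cutoffTensor k X).toLinearMap
  have hmem : ∀ v, v ∈ N ↔
      ∀ X, Λ.cutoffTensor k X v ∈ (Λ.monomialSubmodule hΛ k C).toSubmodule := by
    intro v
    simp [N, Submodule.mem_iInf]
  have hle : (Λ.monomialSubmodule hΛ k C).toSubmodule ≤ N := by
    refine Λ.monomialSubmodule_le hΛ ?_ (fun i v hv => ?_) fun a ha => ?_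
    · rw [Submodule.coe_iInf]
      exact isClosed_iInter fun X =>
        (Λ.monomialSubmodule hΛ k C).isClosed'.preimage (Λ.cutoffTensor k X).continuous
    · rw [hmem] at hv ⊢
      intro X
      rw [cutoffTensor_coordOpTensor]
      exact (Λ.monomialSubmodule hΛ k C).map_mem' i _ (hv _)
    · rw [hmem]
      intro X
      change Λ.cutoff X (Λ.monomial a.1) ⊗ₜ[ℂ] a.2 ∈ _
      by_cases h : a.1 ∈ X
      · rw [cutoff_monomial_of_mem _ h]
        exact Λ.generator_mem hΛ C ha
      · rw [cutoff_monomial_of_notMem _ h, TensorProduct.zero_tmul]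
        exact zero_mem _
  exact (hmem v).1 (hle hv) X

variable {C} in
theorem cutoffTensor_mem_orthogonal (X : Set (MultiIndex m))
    {v : Λ.Space ⊗[ℂ] EuclideanSpace ℂ (Fin k)}
    (hv : v ∈ (Λ.monomialSubmodule hΛ k C).toSubmoduleᗮ) :
    Λ.cutoffTensor k X v ∈ (Λ.monomialSubmodule hΛ k C).toSubmoduleᗮ := by
  intro u hu
  rw [← ContinuousLinearMap.adjoint_inner_left, adjoint_cutoffTensor]
  exact hv _ (Λ.cutoffTensor_mem hΛ X hu)

theorem starProjection_cutoffTensor (X : Set (MultiIndex m))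
    (v : Λ.Space ⊗[ℂ] EuclideanSpace ℂ (Fin k)) :
    (Λ.monomialSubmodule hΛ k C).toSubmodule.starProjection (Λ.cutoffTensor k X v) =
      Λ.cutoffTensor k X ((Λ.monomialSubmodule hΛ k C).toSubmodule.starProjection v) := by
  refine (Submodule.eq_starProjection_of_mem_orthogonal
    (Λ.cutoffTensor_mem hΛ X (Submodule.starProjection_apply_mem _ v)) ?_)
  rw [← map_sub]
  exact Λ.cutoffTensor_mem_orthogonal hΛ X (Submodule.sub_starProjection_mem_orthogonal v)

variable {C} in
-- Test against `Z^α ⊗ x` with `x ∈ E(α)`. The adjoint of `T_i` gives a multiple of `Z^(α - e_i) ⊗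
-- x`, or `0`; for `α - e_i ∈ X` the fibers agree, so this lies in the submodule and is orthogonal
-- to `v`.
theorem coordOpTensor_cutoffTensor_mem_orthogonal {i : Fin m} {X : Set (MultiIndex m)}
    (hX : ∀ α ∈ X, fiber C (α + Pi.single i 1) = fiber C α)
    {v : Λ.Space ⊗[ℂ] EuclideanSpace ℂ (Fin k)}
    (hv : v ∈ (Λ.monomialSubmodule hΛ k C).toSubmoduleᗮ) :
    Λ.coordOpTensor hΛ k i (Λ.cutoffTensor k X v) ∈
      (Λ.monomialSubmodule hΛ k C).toSubmoduleᗮ := by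
  refine Λ.mem_orthogonal_of_forall_monomial hΛ fun α x hx => ?_
  rw [← ContinuousLinearMap.adjoint_inner_left, ← ContinuousLinearMap.adjoint_inner_left,
    adjoint_cutoffTensor, coordOpTensor, ContinuousLinearMap.adjoint_rTensor]
  change inner ℂ (Λ.cutoff X (ContinuousLinearMap.adjoint (Λ.coordOp hΛ i) (Λ.monomial α))
    ⊗ₜ[ℂ] x) v = 0
  by_cases h : α i = 0
  · rw [adjoint_coordOp_monomial_of_eq_zero _ _ h, map_zero, TensorProduct.zero_tmul,
      inner_zero_left]
  · obtain ⟨β, rfl⟩ : ∃ β : MultiIndex m, α = β + Pi.single i 1 :=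
      ⟨_, (MultiIndex.sub_add_single h).symm⟩
    rw [adjoint_coordOp_monomial, map_smul]
    by_cases hβ : β ∈ X
    · rw [cutoff_monomial_of_mem _ hβ, TensorProduct.smul_tmul]
      exact hv _ (Λ.monomial_tmul_mem hΛ (Submodule.smul_mem _ _ (hX β hβ ▸ hx)))
    · rw [cutoff_monomial_of_notMem _ hβ, smul_zero, TensorProduct.zero_tmul, inner_zero_left]

/-- The corner `P T_i (1 - P)` of the coordinate operator `T_i = Z_i ⊗ I` with respect to the
projection `P` onto the submodule. -/
noncomputable def corner (i : Fin m) :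
    Λ.Space ⊗[ℂ] EuclideanSpace ℂ (Fin k) →L[ℂ] Λ.Space ⊗[ℂ] EuclideanSpace ℂ (Fin k) :=
  (Λ.monomialSubmodule hΛ k C).toSubmodule.starProjection * Λ.coordOpTensor hΛ k i *
    (Λ.monomialSubmodule hΛ k C).toSubmoduleᗮ.starProjection

variable {C} in
-- Cutoffs commute with the projection onto the submodule, and the part of the complement beyond the
-- slab `α_i < ν_i` is sent by `T_i` back into the complement, where `P` kills it.
theorem corner_mul_cutoffTensor {ν : MultiIndex m} {i : Fin m}
    (hν : ∀ α : MultiIndex m, ν i ≤ α i → fiber C (α + Pi.single i 1) = fiber C α)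
    (X : Set (MultiIndex m)) :
    Λ.corner hΛ C i * Λ.cutoffTensor k X =
      (Λ.monomialSubmodule hΛ k C).toSubmodule.starProjection *
        (Λ.coordOpTensor hΛ k i * Λ.cutoffTensor k ({α | α i < ν i} ∩ X)) *
          (Λ.monomialSubmodule hΛ k C).toSubmoduleᗮ.starProjection := by
  ext1 v
  have hQ : (Λ.monomialSubmodule hΛ k C).toSubmoduleᗮ.starProjection (Λ.cutoffTensor k X v) =
      Λ.cutoffTensor k X ((Λ.monomialSubmodule hΛ k C).toSubmoduleᗮ.starProjection v) := by
    rw [Submodule.starProjection_orthogonal_val, Submodule.starProjection_orthogonal_val,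
      starProjection_cutoffTensor, map_sub]
  rw [← cutoffTensor_mul]
  simp only [corner, mul_apply_eq_comp]
  rw [hQ]
  set u := Λ.cutoffTensor k X ((Λ.monomialSubmodule hΛ k C).toSubmoduleᗮ.starProjection v) with hu
  have hmem : u ∈ (Λ.monomialSubmodule hΛ k C).toSubmoduleᗮ :=
    Λ.cutoffTensor_mem_orthogonal hΛ X (Submodule.starProjection_apply_mem _ v)
  have hsplit : u = Λ.cutoffTensor k {α | α i < ν i} u + Λ.cutoffTensor k {α | α i < ν i}ᶜ u :=
    (congrArg (· u) (Λ.cutoffTensor_add_compl {α | α i < ν i})).symm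
  have h0 : (Λ.monomialSubmodule hΛ k C).toSubmodule.starProjection
      (Λ.coordOpTensor hΛ k i (Λ.cutoffTensor k {α | α i < ν i}ᶜ u)) = 0 :=
    (Submodule.starProjection_apply_eq_zero_iff _).2
      (Λ.coordOpTensor_cutoffTensor_mem_orthogonal hΛ (fun α hα => hν α (not_lt.1 hα)) hmem)
  conv_lhs => rw [hsplit, map_add, map_add, h0, add_zero]

variable {C} in
theorem norm_corner_mul_cutoffTensor_le {ν : MultiIndex m} {i : Fin m}
    (hν : ∀ α : MultiIndex m, ν i ≤ α i → fiber C (α + Pi.single i 1) = fiber C α)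
    {X : Set (MultiIndex m)} {c : ℝ} (hc : 0 ≤ c)
    (hX : ∀ α ∈ X, α i < ν i → Λ.sqRatio i α ≤ c) :
    ‖Λ.corner hΛ C i * Λ.cutoffTensor k X‖ ≤ √c := by
  rw [Λ.corner_mul_cutoffTensor hΛ hν]
  have h1 := Λ.norm_coordOpTensor_mul_cutoffTensor_le hΛ (k := k) (i := i)
    (X := {α | α i < ν i} ∩ X) (fun α hα => hX α hα.2 hα.1) hc
  exact (norm_mul_mul_le_of_norm_le_one (Submodule.starProjection_norm_le _)
    (Submodule.starProjection_norm_le _)).trans h1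

theorem isSchatten_corner_mul_adjoint_corner (hk : 1 ≤ k) {p : ℝ} (hp : 0 < p)
    (hcomm : ∀ i : Fin m, IsSchatten p (crossCommutator (Λ.coordOp hΛ i) (Λ.coordOp hΛ i)))
    (i j : Fin m) :
    IsSchatten p (Λ.corner hΛ C i * ContinuousLinearMap.adjoint (Λ.corner hΛ C j)) := by
  obtain ⟨ν, hν⟩ := (fiber_mono C).exists_stable_multiIndex
  let F : Fin m → MultiIndex m → ℝ := fun i α => if α i < ν i then Λ.sqRatio i α else 0
  have hF : ∀ i α, 0 ≤ F i α := fun i α => by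
    dsimp only [F]
    split_ifs
    exacts [Λ.sqRatio_nonneg i α, le_rfl]
  have hFs : ∀ i, Summable fun α => F i α ^ p := fun i =>
    Λ.summable_sqRatio hΛ hp (hcomm i) (ν i)
  -- Adding the two families makes one finite set `A` serve both corners: off `A`, each summand is
  -- at most `c`.
  refine isSchatten_of_forall_finset (a := fun α => F i α + F j α) (k := k)
    (fun α => add_nonneg (hF i α) (hF j α)) hp ?_ (by omega) fun A c hc hA => ?_
  · exact Summable.of_nonneg_of_le
      (fun α => Real.rpow_nonneg (add_nonneg (hF i α) (hF j α)) _)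
      (fun α => add_rpow_le_two_rpow_mul (hF i α) (hF j α) hp.le)
      (((hFs i).add (hFs j)).mul_left _)
  · have hbound : ∀ l, (∀ α ∉ A, F l α ≤ c) →
        ‖Λ.corner hΛ C l * Λ.cutoffTensor k (A : Set (MultiIndex m))ᶜ‖ ≤ √c := by
      intro l hl
      refine Λ.norm_corner_mul_cutoffTensor_le hΛ (fun α => hν α l) hc fun α hα hlt => ?_
      have := hl α hα
      simpa only [F, hlt, if_true] using this
    have hi := hbound i fun α hα => by linarith [hA α hα, hF j α]
    have hj := hbound j fun α hα => by linarith [hA α hα, hF i α]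
    have hrank : LinearMap.rank (Λ.corner hΛ C i * Λ.cutoffTensor k A *
        ContinuousLinearMap.adjoint (Λ.corner hΛ C j)).toLinearMap ≤
          ((k * A.card : ℕ) : Cardinal) :=
      (LinearMap.rank_comp_le_left _ _).trans ((LinearMap.rank_comp_le_right _ _).trans
        (Λ.rank_cutoffTensor_le A))
    refine (singularNumber_le hrank).trans ?_
    -- The cutoff to the complement of `A` is a self-adjoint idempotent, so it can be given to both
    -- factors; each then contributes `√c`.
    have heq : Λ.corner hΛ C i * ContinuousLinearMap.adjoint (Λ.corner hΛ C j) -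
        Λ.corner hΛ C i * Λ.cutoffTensor k A * ContinuousLinearMap.adjoint (Λ.corner hΛ C j) =
        (Λ.corner hΛ C i * Λ.cutoffTensor k (A : Set (MultiIndex m))ᶜ) *
          ContinuousLinearMap.adjoint
            (Λ.corner hΛ C j * Λ.cutoffTensor k (A : Set (MultiIndex m))ᶜ) := by
      rw [← ContinuousLinearMap.star_eq_adjoint (Λ.corner hΛ C j * _), star_mul,
        ContinuousLinearMap.star_eq_adjoint, ContinuousLinearMap.star_eq_adjoint,
        adjoint_cutoffTensor, mul_assoc _ _ (_ * _), ← mul_assoc (Λ.cutoffTensor k _),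
        cutoffTensor_mul, Set.inter_self, eq_sub_of_add_eq' (Λ.cutoffTensor_add_compl _)]
      simp only [mul_sub, sub_mul, one_mul, mul_assoc]
    rw [heq]
    calc _ ≤ _ := norm_mul_le _ _
      _ ≤ √c * √c := by
        rw [ContinuousLinearMap.adjoint.norm_map]
        gcongr
      _ = c := Real.mul_self_sqrt hc

end WeightSet

/-! ### Cross-commutators of restrictions, and the conclusion. -/

namespace HilbertSubmodule

variable {ι H : Type*} [NormedAddCommGroup H] [InnerProductSpace ℂ H] [CompleteSpace H]
  {T : ι → H →L[ℂ] H}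

theorem adjoint_coord_apply (S : HilbertSubmodule T) (j : ι) (s : S.toSubmodule) :
    (ContinuousLinearMap.adjoint (S.coord j) s : H) =
      S.toSubmodule.starProjection (ContinuousLinearMap.adjoint (T j) s) := by
  have h : S.coord j = S.toSubmodule.orthogonalProjectionOnto ∘L T j ∘L S.toSubmodule.subtypeL := by
    ext s
    exact (Submodule.starProjection_eq_self_iff.2 (S.map_mem' j s s.2)).symm
  rw [h, ContinuousLinearMap.adjoint_comp, ContinuousLinearMap.adjoint_comp,
    Submodule.adjoint_subtypeL, Submodule.adjoint_orthogonalProjectionOnto]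
  rfl

/-- The cross-commutator of the coordinate operators of a submodule is the compression of the
ambient one minus a product of off-diagonal corners. -/
theorem crossCommutator_coord (S : HilbertSubmodule T) (i j : ι) :
    crossCommutator (S.coord i) (S.coord j) =
      S.toSubmodule.orthogonalProjectionOnto ∘L
        (crossCommutator (T i) (T j) -
          (S.toSubmodule.starProjection * T i * S.toSubmoduleᗮ.starProjection) *
            ContinuousLinearMap.adjoint
              (S.toSubmodule.starProjection * T j * S.toSubmoduleᗮ.starProjection)) ∘L
        S.toSubmodule.subtypeL := by
  have hadj : ContinuousLinearMap.adjoint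
      (S.toSubmodule.starProjection * T j * S.toSubmoduleᗮ.starProjection) =
      S.toSubmoduleᗮ.starProjection *
        (ContinuousLinearMap.adjoint (T j) * S.toSubmodule.starProjection) := by
    rw [← ContinuousLinearMap.star_eq_adjoint, star_mul, star_mul,
      (isSelfAdjoint_starProjection S.toSubmodule).star_eq,
      (isSelfAdjoint_starProjection S.toSubmoduleᗮ).star_eq, ContinuousLinearMap.star_eq_adjoint]
  have hP : ∀ x ∈ S.toSubmodule, S.toSubmodule.starProjection x = x := fun x hx =>
    Submodule.starProjection_eq_self_iff.2 hx
  have hcoe : ∀ (l : ι) (s : S.toSubmodule), (S.coord l s : H) = T l s := fun _ _ => rfl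
  rw [hadj]
  ext s
  change ((S.coord i (ContinuousLinearMap.adjoint (S.coord j) s) : S.toSubmodule) : H) -
      (ContinuousLinearMap.adjoint (S.coord j) (S.coord i s) : S.toSubmodule) =
    S.toSubmodule.starProjection
      (T i (ContinuousLinearMap.adjoint (T j) s) - ContinuousLinearMap.adjoint (T j) (T i s) -
        S.toSubmodule.starProjection (T i (S.toSubmoduleᗮ.starProjection
          (S.toSubmoduleᗮ.starProjection (ContinuousLinearMap.adjoint (T j)
            (S.toSubmodule.starProjection s))))))
  rw [hcoe, adjoint_coord_apply, adjoint_coord_apply, hcoe, hP s s.2,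
    Submodule.starProjection_eq_self_iff.2 (Submodule.starProjection_apply_mem S.toSubmoduleᗮ _),
    Submodule.starProjection_orthogonal_val]
  -- By invariance, `P T_i P = T_i P`. The term with `T_j*` on the left therefore needs no
  -- correction, and the other one loses exactly `P T_i (1 - P) T_j*`.
  have h1 := hP _ (S.map_mem' i _ (Submodule.starProjection_apply_mem S.toSubmodule
    (ContinuousLinearMap.adjoint (T j) s)))
  simp only [map_sub, h1, hP _ (Submodule.starProjection_apply_mem S.toSubmodule _)]
  abel

end HilbertSubmodule

theorem mainTheorem3 {m k : ℕ} (hm : 1 ≤ m) (hk : 1 ≤ k) (Λ : WeightSet m) (hΛ : Λ.IsDecreasing)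
    (p : ℝ) (hp : 0 < p)
    (hcomm : ∀ i j : Fin m, IsSchatten p (crossCommutator (Λ.coordOp hΛ i) (Λ.coordOp hΛ j)))
    (C : Set (MultiIndex m × EuclideanSpace ℂ (Fin k))) :
    ∀ i j : Fin m,
      IsSchatten p (crossCommutator (H := (Λ.monomialSubmodule hΛ k C).toSubmodule)
        ((Λ.monomialSubmodule hΛ k C).coord i) ((Λ.monomialSubmodule hΛ k C).coord j)) := by
  intro i j
  have hT : crossCommutator (Λ.coordOpTensor hΛ k i) (Λ.coordOpTensor hΛ k j) =
      (crossCommutator (Λ.coordOp hΛ i) (Λ.coordOp hΛ j)).rTensor (EuclideanSpace ℂ (Fin k)) := by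
    simp only [crossCommutator, WeightSet.coordOpTensor]
    rw [ContinuousLinearMap.adjoint_rTensor, ContinuousLinearMap.rTensor_sub,
      ContinuousLinearMap.rTensor_mul, ContinuousLinearMap.rTensor_mul]
  rw [HilbertSubmodule.crossCommutator_coord]
  refine IsSchatten.comp hp (IsSchatten.sub hp ?_ ?_) _ _
  · rw [hT]
    exact (hcomm i j).rTensor hp (by omega)
  · exact Λ.isSchatten_corner_mul_adjoint_corner hΛ C hk hp (fun l => hcomm l l) i j
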